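/- Let $\theta\in[0,2\pi)$ with $\theta\neq 0,\pi$, put $c=\cos\theta$, $s=\sin\theta$, and consider the 3-state quantum walk on $\mathbb{Z}$ with amplitudes $|\psi_t(x)\rangle\in\mathbb{C}^3$ (basis $|0\rangle,|1\rangle,|2\rangle$), whose one-step evolution applies at every position the coin $$C=\begin{pmatrix}-\frac{1+c}{2}&\frac{s}{\sqrt2}&\frac{1-c}{2}\\ \frac{s}{\sqrt2}&c&\frac{s}{\sqrt2}\\ \frac{1-c}{2}&\frac{s}{\sqrt2}&-\frac{1+c}{2}\end{pmatrix}$$ and then shifts the component $|0\rangle$ from $x$ to $x-1$, keeps the component $|1\rangle$ at $x$, and shifts the component $|2\rangle$ from $x$ to $x+1$. Write $\mathbb{P}(X_t=x)=\|\psi_t(x)\|^2$. Let $|\phi\rangle=\alpha|0\rangle+\beta|1\rangle+\gamma|2\rangle$ with $\alpha,\beta,\gamma\in\mathbb{C}$, $|\alpha|^2+|\beta|^2+|\gamma|^2=1$, and put $A=2(1-c)\alpha+\sqrt2\,s\beta$, $B=\sqrt2\,s\beta+2(1-c)\gamma$. For a positive integer $n$ let $$M(n)=\left\{1+\left(\tfrac{3-c}{1+c}\right)^2\right\}n-\tfrac12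 ,$$ and let $F(x)=1/\sqrt{M(n)}$ for $x=0,2,4,\ldots,2n-2$ and $F(x)=0$ for all other $x\in\mathbb{Z}$. Then $M(n)>0$ and: (i) $\sum_{x\in\mathbb{Z}}\left|\frac12F(x-1)+\frac{3-c}{1+c}F(x)+\frac12F(x+1)\right|^2=1$, and for all $y\in\mathbb{Z}$, $\int_{-\pi}^{\pi}\sum_{x\in\mathbb{Z}}e^{-ik(x-y)}F(x)\,dk=\sum_{x\in\mathbb{Z}}\int_{-\pi}^{\pi}e^{-ik(x-y)}F(x)\,dk$. The initial state $|\psi_0(x)\rangle=\left\{\frac12F(x-1)+\frac{3-c}{1+c}F(x)+\frac12F(x+1)\right\}|\phi\rangle$ is a unit vector, and it equals $\frac{1}{2\sqrt{M(n)}}|\phi\rangle$ for $x=-1,2n-1$; $\frac{3-c}{(1+c)\sqrt{M(n)}}|\phi\rangle$ for $x=0,2,\ldots,2n-2$; $\frac{1}{\sqrt{M(n)}}|\phi\rangle$ for $x=1,3,\ldots,2n-3$; and $0$ otherwise. (ii) For the walk started from this state, the limit of the probabilities exists at every position and $$\lim_{t\to\infty}\mathbb{P}(X_t=x)=\begin{cases}\frac{(3-c)|B|^2}{8(1+c)s^2M(n)}&(x=-1),\\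 \frac{1}{4(1+c)M(n)}\left\{\frac{|A|^2+|B|^2}{1+c}+\frac{|A+B|^2}{2(1-c)}\right\}&(x=0,1,\ldots,2n-2),\\ \frac{(3-c)|A|^2}{8(1+c)s^2M(n)}&(x=2n-1),\\ 0&(\text{otherwise}).\end{cases}$$ (iii) If $A=0$ and $B\neq0$ (for example $\alpha=\beta=0$, $\gamma=1$), the limit is the positive constant $\frac{(3-c)|B|^2}{8(1+c)s^2M(n)}$ on the $2n$ points $x=-1,0,\ldots,2n-2$ and $0$ elsewhere. (iv) If $A\neq0$ and $B=0$ (for example $\alpha=1$, $\beta=\gamma=0$), the limit is the positive constant $\frac{(3-c)|A|^2}{8(1+c)s^2M(n)}$ on the $2n$ points $x=0,1,\ldots,2n-1$ and $0$ elsewhere. (v) If $B=-A\neq0$, the limit is $\frac{(3-c)|A|^2}{8(1+c)s^2M(n)}$ at $x=-1,2n-1$, it is $\frac{|A|^2}{2(1+c)^2M(n)}$ at $x=0,1,\ldots,2n-2$, and $0$ elsewhere. If moreover $c=\frac13$ and $s=\pm\frac{2\sqrt2}{3}$, then the condition $B=-A\neq0$ is equivalent to $\beta=\mp\frac12(\alpha+\gamma)$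 with $\gamma\neq\alpha$ (respectively), and under it the limit is the positive constant $\frac{|\alpha-\gamma|^2}{4(10n-1)}$ on the $2n+1$ points $x=-1,0,\ldots,2n-1$ and $0$ elsewhere. -/

import Mathlib

open Filter Topology

noncomputable section

namespace ThreeStateWalk

/-- A state of the walker: `ψ x j` is the amplitude of `|x⟩ ⊗ |j⟩`, with `x ∈ ℤ`, `j ∈ {0, 1, 2}`. -/
abbrev State : Type := ℤ → Fin 3 → ℂ

/-- The coin matrix with `c = cos θ` and `s = sin θ`. -/
def coin (θ : ℝ) : Matrix (Fin 3) (Fin 3) ℂ :=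
  (!![-(1 + Real.cos θ) / 2, Real.sin θ / √2, (1 - Real.cos θ) / 2;
      Real.sin θ / √2, Real.cos θ, Real.sin θ / √2;
      (1 - Real.cos θ) / 2, Real.sin θ / √2, -(1 + Real.cos θ) / 2] :
    Matrix (Fin 3) (Fin 3) ℝ).map (fun r : ℝ => (r : ℂ))

/-- The coin is applied at every position. -/
def applyCoin (θ : ℝ) (ψ : State) : State := fun x => (coin θ).mulVec (ψ x)

/-- The position shift: coin state `0` moves from `x` to `x - 1`, coin state `1` stays,
coin state `2` moves from `x` to `x + 1`. -/
def shift (ψ : State) : State := fun x => ![ψ (x + 1) 0, ψ x 1, ψ (x - 1) 2]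

/-- The state at time `t` of the walk that starts from `ψ₀`. -/
def evolve (θ : ℝ) (ψ₀ : State) (t : ℕ) : State :=
  (fun ψ => shift (applyCoin θ ψ))^[t] ψ₀

/-- The probability of observing the walker with state `ψ` at position `x`. -/
def prob (ψ : State) (x : ℤ) : ℝ := ∑ j, ‖ψ x j‖ ^ 2

/-- The delocalized initial state generated by `F : ℤ → ℂ` and the coin vector `φ`. -/
def delocalized (θ : ℝ) (F : ℤ → ℂ) (φ : Fin 3 → ℂ) : State := fun x =>
  (1 / 2 * F (x - 1) + (((3 - Real.cos θ) / (1 + Real.cos θ) : ℝ) : ℂ) * F x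
    + 1 / 2 * F (x + 1)) • φ

/-- The constant `M(n)`. -/
def normConst (θ : ℝ) (n : ℕ) : ℝ :=
  (1 + ((3 - Real.cos θ) / (1 + Real.cos θ)) ^ 2) * n - 1 / 2

/-- The function `F`: it is `1 / √M(n)` on `0, 2, 4, …, 2n - 2` and `0` elsewhere. -/
def evenStep (θ : ℝ) (n : ℕ) : ℤ → ℂ := fun x =>
  if 0 ≤ x ∧ x ≤ 2 * (n : ℤ) - 2 ∧ Even x then ((1 / √(normConst θ n) : ℝ) : ℂ) else 0

/-- `A = 2(1 - c)α + √2 s β`. -/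
def coeffA (θ : ℝ) (α β : ℂ) : ℂ :=
  ((2 * (1 - Real.cos θ) : ℝ) : ℂ) * α + ((√2 * Real.sin θ : ℝ) : ℂ) * β

/-- `B = √2 s β + 2(1 - c)γ`. -/
def coeffB (θ : ℝ) (β γ : ℂ) : ℂ :=
  ((√2 * Real.sin θ : ℝ) : ℂ) * β + ((2 * (1 - Real.cos θ) : ℝ) : ℂ) * γ

/-- The probabilities `P t x` converge as `t → ∞`, for every `x`, to the uniform measure with
mass `v > 0` at each point of `S` and mass `0` outside `S`. -/
def HasUniformLimit (P : ℕ → ℤ → ℝ) (S : Finset ℤ) (v : ℝ) : Prop :=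
  0 < v ∧ (∀ x ∈ S, Tendsto (fun t => P t x) atTop (𝓝 v)) ∧
    ∀ x ∉ S, Tendsto (fun t => P t x) atTop (𝓝 0)

end ThreeStateWalk

end

/-! Let `U` be one step of the walk and `w = c - (1+c) cos k` in Fourier space. Cayley–Hamilton
reads `(U - 1) p(U) = 0` with `p(U) = U² + (1-w)U + 1`. Hence the range of `p(U)` is fixed by `U`,
while on the range of `1 - U` the iterates obey the scalar recurrence `f (t+2) = 2X f (t+1) - f t`,
where `X = -(1-w)/2` is the wave symbol.

The stencil of the delocalized state is exactly `p(1)/(1+c)`, because `p(1) = 3 - w`. Writing `p(1)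
= p(U) + (1-U)(U + 2 - w)` splits the initial state, without inverting any symbol, into a stationary
state plus `χ - Uχ` with `χ` finitely supported (`delocalized_eq`).

The second summand vanishes pointwise in the limit. Its evolution is a finite combination of Fourier
coefficients of Chebyshev polynomials `U_n(X)`. Integration by parts (`mul_waveKernel_T`) turns
differences of these coefficients at distance two into coefficients of `T_n(X)` with a factor
`O(1/n)`, and `|T_n| ≤ 1` on `[-1, 1]`. The evolution is therefore asymptotically 2-periodic in
space; being bounded in `ℓ²` by unitarity, it tends to `0` (`tendsto_zero_of_tendsto_sub`). No
stationary phase estimate is needed.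

The limit law is thus that of the stationary state. Its profile equals, up to a constant, `B` at
even and `A` at odd points of `0, …, 2n-1`, so every interior site sees one `A` and one `B`, and
each end site sees only one of them. -/

/-! ### Fourier coefficients of Chebyshev polynomials of the wave symbol -/

/-- The symbol of the wave operator driving the non-stationary part of the walk. -/
noncomputable def waveSymbol (c k : ℝ) : ℝ := -(1 - c) / 2 - (1 + c) / 2 * Real.cos k

open Polynomial in
/-- The `x`-th Fourier coefficient of `P` evaluated at the wave symbol. -/
noncomputable def waveKernel (c : ℝ) (P : ℝ[X]) (x : ℤ) : ℝ :=
  (2 * Real.pi)⁻¹ * ∫ k in (-Real.pi)..Real.pi, P.eval (waveSymbol c k) * Real.cos (k * x)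

theorem continuous_waveSymbol (c : ℝ) : Continuous (waveSymbol c) := by
  unfold waveSymbol; fun_prop

theorem continuous_eval_waveSymbol (c : ℝ) (P : Polynomial ℝ) :
    Continuous fun k => P.eval (waveSymbol c k) :=
  P.continuous.comp (continuous_waveSymbol c)

/-- Multiplication by the symbol becomes a nearest-neighbour stencil, by the addition formula for
`cos (k (x ± 1))`. This transports the Chebyshev recurrence to the kernels. -/
theorem waveKernel_wave (c : ℝ) (P Q : Polynomial ℝ) (x : ℤ) :
    waveKernel c (2 * Polynomial.X * P - Q) x = -(1 - c) * waveKernel c P x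
      - (1 + c) / 2 * (waveKernel c P (x + 1) + waveKernel c P (x - 1)) - waveKernel c Q x := by
  unfold waveKernel
  have hP := continuous_eval_waveSymbol c P
  have hQ := continuous_eval_waveSymbol c Q
  have hi (R : Polynomial ℝ) (y : ℤ) : IntervalIntegrable
      (fun k => R.eval (waveSymbol c k) * Real.cos (k * y)) MeasureTheory.volume
      (-Real.pi) Real.pi := by
    have hR := continuous_eval_waveSymbol c R
    exact (by fun_prop : Continuous _).intervalIntegrable _ _
  have key : ∀ k : ℝ, (2 * Polynomial.X * P - Q).eval (waveSymbol c k) * Real.cos (k * x) =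
      -(1 - c) * (P.eval (waveSymbol c k) * Real.cos (k * x))
      - (1 + c) / 2 * (P.eval (waveSymbol c k) * Real.cos (k * (x + 1 : ℤ))
        + P.eval (waveSymbol c k) * Real.cos (k * (x - 1 : ℤ)))
      - Q.eval (waveSymbol c k) * Real.cos (k * x) := by
    intro k
    push_cast
    rw [show k * ((x : ℝ) + 1) = k * x + k by ring, show k * ((x : ℝ) - 1) = k * x - k by ring,
      Real.cos_add, Real.cos_sub]
    simp only [Polynomial.eval_sub, Polynomial.eval_mul, Polynomial.eval_X, Polynomial.eval_ofNat]
    unfold waveSymbol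
    ring
  simp_rw [key]
  rw [intervalIntegral.integral_sub _ (hi Q x), intervalIntegral.integral_sub,
    intervalIntegral.integral_const_mul, intervalIntegral.integral_const_mul,
    intervalIntegral.integral_add (hi P _) (hi P _)]
  · ring
  · exact (hi P x).const_mul _
  · exact ((hi P _).add (hi P _)).const_mul _
  · exact ((hi P x).const_mul _).sub (((hi P _).add (hi P _)).const_mul _)

theorem waveKernel_zero (c : ℝ) (x : ℤ) : waveKernel c 0 x = 0 := by
  simp [waveKernel]

theorem waveKernel_neg (c : ℝ) (P : Polynomial ℝ) (x : ℤ) :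
    waveKernel c (-P) x = -waveKernel c P x := by
  simp [waveKernel]

theorem waveKernel_one (c : ℝ) (x : ℤ) : waveKernel c 1 x = if x = 0 then 1 else 0 := by
  unfold waveKernel
  have hpi := Real.pi_pos
  split_ifs with h
  · subst h
    simp
    field_simp
    norm_num
  · have hx : (x : ℝ) ≠ 0 := by exact_mod_cast h
    have : ∫ k in (-Real.pi)..Real.pi, Real.cos (k * x) = 0 := by
      rw [intervalIntegral.integral_comp_mul_right (fun k => Real.cos k) hx, integral_cos,
        neg_mul, Real.sin_neg, mul_comm Real.pi, Real.sin_int_mul_pi]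
      simp
    simp [this]

theorem abs_waveSymbol_le {c : ℝ} (h1 : -1 ≤ c) (h2 : c ≤ 1) (k : ℝ) :
    |waveSymbol c k| ≤ 1 := by
  unfold waveSymbol
  rw [abs_le]
  have := Real.cos_le_one k
  have := Real.neg_one_le_cos k
  constructor <;> nlinarith

theorem abs_waveKernel_T_le {c : ℝ} (h1 : -1 ≤ c) (h2 : c ≤ 1) (n x : ℤ) :
    |waveKernel c (Polynomial.Chebyshev.T ℝ n) x| ≤ 1 := by
  have hpi := Real.pi_pos
  have := intervalIntegral.norm_integral_le_of_norm_le_const (a := -Real.pi) (b := Real.pi)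
    (C := 1)
    (f := fun k => (Polynomial.Chebyshev.T ℝ n).eval (waveSymbol c k) * Real.cos (k * x)) (by
      intro k _
      rw [norm_mul, Real.norm_eq_abs, Real.norm_eq_abs]
      exact mul_le_one₀ (Polynomial.Chebyshev.abs_eval_T_real_le_one n (abs_waveSymbol_le h1 h2 k))
        (abs_nonneg _) (Real.abs_cos_le_one _))
  unfold waveKernel
  rw [abs_mul, abs_of_pos (by positivity : 0 < (2 * Real.pi)⁻¹), inv_mul_le_iff₀ (by positivity)]
  rw [Real.norm_eq_abs] at this
  refine this.trans ?_
  rw [abs_of_pos (by linarith)]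
  linarith

/-- Integration by parts against `sin (k x)`, whose boundary terms vanish since `x` is an integer.
It uses `T_n' = n U_(n-1)`, and the factor `sin k` from the symbol's derivative combines with `sin
(k x)` into a difference of cosines. -/
theorem mul_waveKernel_T (c : ℝ) (n x : ℤ) :
    x * waveKernel c (Polynomial.Chebyshev.T ℝ n) x = n * ((1 + c) / 4) *
      (waveKernel c (Polynomial.Chebyshev.U ℝ (n - 1)) (x + 1)
        - waveKernel c (Polynomial.Chebyshev.U ℝ (n - 1)) (x - 1)) := by
  set T := Polynomial.Chebyshev.T ℝ n
  set V := Polynomial.Chebyshev.U ℝ (n - 1)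
  have hT := continuous_eval_waveSymbol c T
  have hV := continuous_eval_waveSymbol c V
  have hder (k : ℝ) : HasDerivAt (fun k => T.eval (waveSymbol c k) * Real.sin (k * x))
      (x * (T.eval (waveSymbol c k) * Real.cos (k * x)) - n * ((1 + c) / 4) *
        (V.eval (waveSymbol c k) * Real.cos (k * (x + 1 : ℤ))
          - V.eval (waveSymbol c k) * Real.cos (k * (x - 1 : ℤ)))) k := by
    have hw : HasDerivAt (waveSymbol c) ((1 + c) / 2 * Real.sin k) k := by
      unfold waveSymbol
      exact (((Real.hasDerivAt_cos k).const_mul ((1 + c) / 2)).const_sub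
        (-(1 - c) / 2)).congr_deriv (by ring)
    have h1 := (T.hasDerivAt (waveSymbol c k)).comp k hw
    have h2 := (Real.hasDerivAt_sin (k * x)).comp k ((hasDerivAt_id k).mul_const (x : ℝ))
    refine (h1.mul h2).congr_deriv ?_
    rw [Polynomial.Chebyshev.T_derivative_eq_U]
    push_cast
    rw [show k * ((x : ℝ) + 1) = k * x + k by ring, show k * ((x : ℝ) - 1) = k * x - k by ring,
      Real.cos_add, Real.cos_sub]
    simp only [Polynomial.eval_mul, Polynomial.eval_intCast, Function.comp_apply, id]
    ring
  have hi (R : Polynomial ℝ) (y : ℤ) : IntervalIntegrable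
      (fun k => R.eval (waveSymbol c k) * Real.cos (k * y)) MeasureTheory.volume
      (-Real.pi) Real.pi := by
    have hR := continuous_eval_waveSymbol c R
    exact (by fun_prop : Continuous _).intervalIntegrable _ _
  have hint := intervalIntegral.integral_eq_sub_of_hasDerivAt (a := -Real.pi) (b := Real.pi)
    (fun k _ => hder k)
    (((hi T x).const_mul _).sub (((hi V _).sub (hi V _)).const_mul _))
  rw [intervalIntegral.integral_sub ((hi T x).const_mul _) (((hi V _).sub (hi V _)).const_mul _),
    intervalIntegral.integral_const_mul, intervalIntegral.integral_const_mul,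
    intervalIntegral.integral_sub (hi V _) (hi V _), neg_mul, Real.sin_neg, mul_comm Real.pi,
    Real.sin_int_mul_pi] at hint
  unfold waveKernel
  linear_combination (2 * Real.pi)⁻¹ * hint

/-- Individual `U_n` are not uniformly bounded on `[-1, 1]`, but the difference is `4x / ((1+c)t)`
times a coefficient of `T_t`, which is at most `1` in modulus. -/
theorem tendsto_waveKernel_U_sub {c : ℝ} (h1 : -1 < c) (h2 : c ≤ 1) (x : ℤ) :
    Tendsto (fun t : ℕ => waveKernel c (Polynomial.Chebyshev.U ℝ ((t : ℤ) - 1)) (x + 1)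
      - waveKernel c (Polynomial.Chebyshev.U ℝ ((t : ℤ) - 1)) (x - 1)) atTop (𝓝 0) := by
  have hlim : Tendsto (fun t : ℕ => (4 * |(x : ℝ)| / (1 + c)) / (t : ℝ)) atTop (𝓝 0) :=
    tendsto_const_div_atTop_nhds_zero_nat _
  refine squeeze_zero_norm' ?_ hlim
  filter_upwards [eventually_gt_atTop 0] with t ht
  have hc : 0 < 1 + c := by linarith
  have ht' : (0 : ℝ) < t := by exact_mod_cast ht
  have h := congrArg abs (mul_waveKernel_T c t x)
  rw [abs_mul, abs_mul, abs_of_pos (by push_cast; positivity :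
    (0 : ℝ) < ((t : ℤ) : ℝ) * ((1 + c) / 4))] at h
  have hb := mul_le_mul_of_nonneg_left (abs_waveKernel_T_le h1.le h2 t x) (abs_nonneg (x : ℝ))
  rw [Real.norm_eq_abs, div_div, le_div_iff₀ (by positivity)]
  push_cast at h
  nlinarith

/-! ### Pointwise decay for the wave recurrence -/

/-- Solutions of the wave recurrence with finitely supported initial data are convolutions of
these data with the kernels of the Chebyshev polynomials. -/
theorem wave_eq_sum_waveKernel (c : ℝ) (f : ℕ → ℤ → ℂ) (S : Finset ℤ)
    (h0 : ∀ x ∉ S, f 0 x = 0) (h1 : ∀ x ∉ S, f 1 x = 0)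
    (hf : ∀ t x, f (t + 2) x = -(1 - c) * f (t + 1) x
      - (1 + c) / 2 * (f (t + 1) (x + 1) + f (t + 1) (x - 1)) - f t x) (t : ℕ) (x : ℤ) :
    f t x = ∑ y ∈ S,
      ((waveKernel c (Polynomial.Chebyshev.U ℝ ((t : ℤ) - 1)) (x - y) : ℂ) * f 1 y
        - (waveKernel c (Polynomial.Chebyshev.U ℝ ((t : ℤ) - 2)) (x - y) : ℂ) * f 0 y) := by
  induction t using Nat.twoStepInduction generalizing x with
  | zero =>
    -- The values `U_(-1) = 0` and `U_(-2) = -1` make the formula return the initial datum at time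
    -- `0`.
    have hU : Polynomial.Chebyshev.U ℝ (-2) = -1 := by simp
    simp only [Nat.cast_zero, zero_sub, Polynomial.Chebyshev.U_neg_one, hU, waveKernel_neg,
      waveKernel_one, waveKernel_zero, sub_eq_zero]
    by_cases hx : x ∈ S
    · simp [hx, apply_ite Complex.ofReal]
    · simp [hx, apply_ite Complex.ofReal, h0]
  | one =>
    simp only [Nat.cast_one, sub_self, Polynomial.Chebyshev.U_zero,
      (by norm_num : (1 : ℤ) - 2 = -1), Polynomial.Chebyshev.U_neg_one,
      waveKernel_one, waveKernel_zero, sub_eq_zero]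
    by_cases hx : x ∈ S
    · simp [hx, apply_ite Complex.ofReal]
    · simp [hx, apply_ite Complex.ofReal, h1]
  | more t ih0 ih1 =>
    have hU (m : ℤ) : Polynomial.Chebyshev.U ℝ (m + 2) = 2 * Polynomial.X *
        Polynomial.Chebyshev.U ℝ (m + 1) - Polynomial.Chebyshev.U ℝ m :=
      Polynomial.Chebyshev.U_add_two ℝ m
    rw [hf, ih0, ih1, ih1, ih1, Finset.mul_sum, ← Finset.sum_add_distrib, Finset.mul_sum,
      ← Finset.sum_sub_distrib, ← Finset.sum_sub_distrib]
    refine Finset.sum_congr rfl fun y _ => ?_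
    push_cast
    rw [show (t : ℤ) + 2 - 1 = ((t : ℤ) - 1) + 2 by ring,
      show (t : ℤ) + 2 - 2 = ((t : ℤ) - 2) + 2 by ring, hU, hU, waveKernel_wave, waveKernel_wave,
      show (t : ℤ) - 1 + 1 = t by ring, show (t : ℤ) + 1 - 1 = t by ring,
      show (t : ℤ) - 2 + 1 = t - 1 by ring, show (t : ℤ) + 1 - 2 = t - 1 by ring,
      show x + 1 - y = x - y + 1 by ring, show x - 1 - y = x - y - 1 by ring]
    push_cast
    ring

theorem tendsto_wave_sub {c : ℝ} (hc1 : -1 < c) (hc2 : c ≤ 1) (f : ℕ → ℤ → ℂ) (S : Finset ℤ)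
    (h0 : ∀ x ∉ S, f 0 x = 0) (h1 : ∀ x ∉ S, f 1 x = 0)
    (hf : ∀ t x, f (t + 2) x = -(1 - c) * f (t + 1) x
      - (1 + c) / 2 * (f (t + 1) (x + 1) + f (t + 1) (x - 1)) - f t x) (x : ℤ) :
    Tendsto (fun t => f t (x + 1) - f t (x - 1)) atTop (𝓝 0) := by
  have key (z : ℤ) : Tendsto (fun t : ℕ =>
      ((waveKernel c (Polynomial.Chebyshev.U ℝ ((t : ℤ) - 1)) (z + 1)
      - waveKernel c (Polynomial.Chebyshev.U ℝ ((t : ℤ) - 1)) (z - 1) : ℝ) : ℂ)) atTop (𝓝 0) := by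
    exact_mod_cast (Complex.continuous_ofReal.tendsto 0).comp (tendsto_waveKernel_U_sub hc1 hc2 z)
  -- Starting at time `1` gives both Chebyshev indices the form "natural number minus one".
  rw [← tendsto_add_atTop_iff_nat 1]
  have hsum : Tendsto (fun t : ℕ => ∑ y ∈ S,
      (((waveKernel c (Polynomial.Chebyshev.U ℝ (((t + 1 : ℕ) : ℤ) - 1)) (x - y + 1)
      - waveKernel c (Polynomial.Chebyshev.U ℝ (((t + 1 : ℕ) : ℤ) - 1)) (x - y - 1) : ℝ) : ℂ)
        * f 1 y
      - ((waveKernel c (Polynomial.Chebyshev.U ℝ ((t : ℤ) - 1)) (x - y + 1)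
      - waveKernel c (Polynomial.Chebyshev.U ℝ ((t : ℤ) - 1)) (x - y - 1) : ℝ) : ℂ) * f 0 y))
      atTop (𝓝 (∑ y ∈ S, (0 * f 1 y - 0 * f 0 y))) :=
    tendsto_finsetSum S fun y _ =>
      (((tendsto_add_atTop_iff_nat 1).2 (key (x - y))).mul_const _).sub ((key (x - y)).mul_const _)
  simp only [zero_mul, sub_zero, Finset.sum_const_zero] at hsum
  refine hsum.congr fun t => ?_
  rw [wave_eq_sum_waveKernel c f S h0 h1 hf (t + 1) (x + 1),
    wave_eq_sum_waveKernel c f S h0 h1 hf (t + 1) (x - 1), ← Finset.sum_sub_distrib]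
  refine Finset.sum_congr rfl fun y _ => ?_
  rw [show (((t + 1 : ℕ) : ℤ) - 2) = (t : ℤ) - 1 by push_cast; ring,
    show x + 1 - y = x - y + 1 by ring, show x - 1 - y = x - y - 1 by ring]
  push_cast
  ring

/-- A sequence of functions on `ℤ` that is bounded in `ℓ²` and asymptotically invariant under
translation by `2` tends to `0` pointwise. -/
theorem tendsto_zero_of_tendsto_sub {f : ℕ → ℤ → ℂ} {K : ℝ}
    (hK : ∀ t (S : Finset ℤ), ∑ x ∈ S, ‖f t x‖ ^ 2 ≤ K)
    (hf : ∀ x, Tendsto (fun t => f t (x + 1) - f t (x - 1)) atTop (𝓝 0)) (x : ℤ) :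
    Tendsto (fun t => f t x) atTop (𝓝 0) := by
  have hd (m : ℕ) : Tendsto (fun t => f t (x + 2 * m) - f t x) atTop (𝓝 0) := by
    induction m with
    | zero => simp
    | succ m ih =>
      have := (hf (x + 2 * m + 1)).add ih
      rw [add_zero] at this
      refine this.congr fun t => ?_
      rw [show x + 2 * (m : ℤ) + 1 + 1 = x + 2 * ((m + 1 : ℕ) : ℤ) by push_cast; ring,
        show x + 2 * (m : ℤ) + 1 - 1 = x + 2 * m by ring]
      ring
  have hsq : Tendsto (fun t => ‖f t x‖ ^ 2) atTop (𝓝 0) := by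
    rw [Metric.tendsto_atTop]
    intro ε hε
    -- The `N` translates `x + 2m` eventually carry nearly the same value, so `N ‖f t x‖² ≤ 2K + 1`,
    -- where the `1` absorbs the differences.
    obtain ⟨N, hN⟩ := exists_nat_gt ((2 * K + 1) / ε)
    have hK0 : 0 ≤ K := by simpa using hK 0 ∅
    have hN0 : (0 : ℝ) < N := lt_of_le_of_lt (by positivity) hN
    have hs : Tendsto (fun t => ∑ m ∈ Finset.range N, 2 * ‖f t (x + 2 * m) - f t x‖ ^ 2) atTop
        (𝓝 (∑ m ∈ Finset.range N, 2 * ‖(0 : ℂ)‖ ^ 2)) :=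
      tendsto_finsetSum _ fun m _ => ((hd m).norm.pow 2).const_mul 2
    have hev : ∀ᶠ t in atTop, ∑ m ∈ Finset.range N, 2 * ‖f t (x + 2 * m) - f t x‖ ^ 2 < 1 :=
      hs.eventually_lt_const (by simp)
    obtain ⟨t₀, ht₀⟩ := eventually_atTop.1 hev
    refine ⟨t₀, fun t ht => ?_⟩
    have h1 := ht₀ t ht
    have h2 : ∑ m ∈ Finset.range N, ‖f t (x + 2 * m)‖ ^ 2 ≤ K := by
      have := hK t ((Finset.range N).image fun m : ℕ => x + 2 * (m : ℤ))
      rwa [Finset.sum_image (by intro a _ b _ h; simpa using h)] at this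
    have h3 : ∑ m ∈ Finset.range N, ‖f t x‖ ^ 2 ≤ ∑ m ∈ Finset.range N,
        (2 * ‖f t (x + 2 * m)‖ ^ 2 + 2 * ‖f t (x + 2 * m) - f t x‖ ^ 2) := by
      refine Finset.sum_le_sum fun m _ => ?_
      have h4 : ‖f t x‖ ≤ ‖f t (x + 2 * m)‖ + ‖f t (x + 2 * m) - f t x‖ := by
        have := norm_sub_le (f t (x + 2 * m)) (f t (x + 2 * m) - f t x)
        rwa [sub_sub_cancel] at this
      nlinarith [norm_nonneg (f t x), norm_nonneg (f t (x + 2 * m)),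
        norm_nonneg (f t (x + 2 * m) - f t x),
        sq_nonneg (‖f t (x + 2 * m)‖ - ‖f t (x + 2 * m) - f t x‖)]
    rw [Finset.sum_add_distrib, ← Finset.mul_sum, Finset.sum_const, Finset.card_range,
      nsmul_eq_mul] at h3
    rw [dist_zero_right, Real.norm_of_nonneg (by positivity)]
    rw [div_lt_iff₀ hε] at hN
    by_contra hcon
    push Not at hcon
    have := mul_le_mul_of_nonneg_left hcon hN0.le
    linarith
  have := hsq.sqrt
  simp only [Real.sqrt_zero, Real.sqrt_sq (norm_nonneg _)] at this
  exact tendsto_zero_iff_norm_tendsto_zero.2 this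

namespace ThreeStateWalk

/-! ### Algebra and unitarity of the step operator -/

/-- One step of the walk. -/
noncomputable def step (θ : ℝ) (ψ : State) : State := shift (applyCoin θ ψ)

theorem evolve_zero (θ : ℝ) (ψ : State) : evolve θ ψ 0 = ψ := rfl

theorem evolve_succ (θ : ℝ) (ψ : State) (t : ℕ) :
    evolve θ ψ (t + 1) = step θ (evolve θ ψ t) :=
  Function.iterate_succ_apply' _ _ _

/-- The off-diagonal coin entry `s / √2`. -/
noncomputable def sideEntry (θ : ℝ) : ℂ := ((Real.sin θ / √2 : ℝ) : ℂ)

theorem sideEntry_sq (θ : ℝ) : sideEntry θ ^ 2 = (1 - (Real.cos θ : ℂ) ^ 2) / 2 := by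
  unfold sideEntry
  rw [← Complex.ofReal_pow, div_pow, Real.sq_sqrt (by norm_num), Real.sin_sq]
  push_cast
  ring

theorem step_apply_zero (θ : ℝ) (ψ : State) (x : ℤ) :
    step θ ψ x 0 = -(1 + (Real.cos θ : ℂ)) / 2 * ψ (x + 1) 0 + sideEntry θ * ψ (x + 1) 1
      + (1 - (Real.cos θ : ℂ)) / 2 * ψ (x + 1) 2 := by
  simp [step, shift, applyCoin, coin, Matrix.mulVec, dotProduct, Fin.sum_univ_three, sideEntry]

theorem step_apply_one (θ : ℝ) (ψ : State) (x : ℤ) :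
    step θ ψ x 1 = sideEntry θ * ψ x 0 + (Real.cos θ : ℂ) * ψ x 1 + sideEntry θ * ψ x 2 := by
  simp [step, shift, applyCoin, coin, Matrix.mulVec, dotProduct, Fin.sum_univ_three, sideEntry]

theorem step_apply_two (θ : ℝ) (ψ : State) (x : ℤ) :
    step θ ψ x 2 = (1 - (Real.cos θ : ℂ)) / 2 * ψ (x - 1) 0 + sideEntry θ * ψ (x - 1) 1
      - (1 + (Real.cos θ : ℂ)) / 2 * ψ (x - 1) 2 := by
  simp [step, shift, applyCoin, coin, Matrix.mulVec, dotProduct, Fin.sum_univ_three, sideEntry]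
  ring

/-- The Cayley–Hamilton identity of the walk, as a Laurent polynomial matrix. -/
theorem step_cayley_hamilton (θ : ℝ) (ψ : State) (x : ℤ) (j : Fin 3) :
    step θ (step θ (step θ ψ)) x j
      - (Real.cos θ * step θ (step θ ψ) x j - (1 + Real.cos θ) / 2 *
        (step θ (step θ ψ) (x + 1) j + step θ (step θ ψ) (x - 1) j))
      + (Real.cos θ * step θ ψ x j - (1 + Real.cos θ) / 2 *
        (step θ ψ (x + 1) j + step θ ψ (x - 1) j)) - ψ x j = 0 := by
  have e1 : x + 1 - 1 = x := by ring
  have e2 : x - 1 + 1 = x := by ring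
  have hσ := sideEntry_sq θ
  -- The identity is polynomial in the coin entries modulo the single relation `σ² = (1 - c²)/2`;
  -- this supplies the multiple of it that is needed.
  have h := congrArg ((step θ ψ (x + 1) j + step θ ψ (x - 1) j + 2 * ψ x j) * ·) hσ
  fin_cases j
  all_goals
    simp only [Fin.zero_eta, Fin.mk_one, Fin.reduceFinMk, step_apply_zero, step_apply_one,
      step_apply_two, e1, e2] at h ⊢
    linear_combination h

theorem step_add (θ : ℝ) (ψ χ : State) : step θ (ψ + χ) = step θ ψ + step θ χ := by
  ext x j
  fin_cases j <;> simp [step_apply_zero, step_apply_one, step_apply_two] <;> ring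

theorem step_sub (θ : ℝ) (ψ χ : State) : step θ (ψ - χ) = step θ ψ - step θ χ := by
  ext x j
  fin_cases j <;> simp [step_apply_zero, step_apply_one, step_apply_two] <;> ring

theorem evolve_add (θ : ℝ) (ψ χ : State) (t : ℕ) :
    evolve θ (ψ + χ) t = evolve θ ψ t + evolve θ χ t := by
  induction t with
  | zero => rfl
  | succ t ih => rw [evolve_succ, evolve_succ, evolve_succ, ih, step_add]

theorem evolve_sub_step (θ : ℝ) (χ : State) (t : ℕ) :
    evolve θ (χ - step θ χ) t = evolve θ χ t - step θ (evolve θ χ t) := by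
  induction t with
  | zero => rfl
  | succ t ih => rw [evolve_succ, ih, step_sub, evolve_succ]

theorem evolve_eq_self {θ : ℝ} {ψ : State} (h : step θ ψ = ψ) (t : ℕ) : evolve θ ψ t = ψ := by
  induction t with
  | zero => rfl
  | succ t ih => rw [evolve_succ, ih, h]

theorem prob_nonneg (ψ : State) (x : ℤ) : 0 ≤ prob ψ x :=
  Finset.sum_nonneg fun _ _ => by positivity

theorem normSq_le_prob (ψ : State) (x : ℤ) (j : Fin 3) : ‖ψ x j‖ ^ 2 ≤ prob ψ x :=
  Finset.single_le_sum (f := fun j => ‖ψ x j‖ ^ 2) (fun _ _ => by positivity) (Finset.mem_univ j)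

theorem prob_applyCoin (θ : ℝ) (ψ : State) (x : ℤ) : prob (applyCoin θ ψ) x = prob ψ x := by
  have h : ∀ z : ℂ, ((‖z‖ ^ 2 : ℝ) : ℂ) = z * (starRingEnd ℂ) z := fun z => by
    rw [Complex.mul_conj, Complex.normSq_eq_norm_sq]
  have hσ : (((Real.sin θ / √2 : ℝ) : ℂ)) ^ 2 = (1 - (Real.cos θ : ℂ) ^ 2) / 2 := sideEntry_sq θ
  apply Complex.ofReal_injective
  simp only [prob, Fin.sum_univ_three, Complex.ofReal_add, h, applyCoin, coin, Matrix.mulVec,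
    dotProduct, Matrix.map_apply, Matrix.of_apply, Matrix.cons_val', Matrix.cons_val_zero,
    Matrix.cons_val_one, Matrix.cons_val, map_add, map_mul, Complex.conj_ofReal]
  -- The coin is real, so amplitudes and their conjugates can be treated as independent variables;
  -- orthogonality then rests only on the relation for `σ²`.
  generalize ((Real.sin θ / √2 : ℝ) : ℂ) = σ at hσ ⊢
  generalize Real.cos θ = c at hσ ⊢
  push_cast
  generalize ψ x 0 = a
  generalize ψ x 1 = b
  generalize ψ x 2 = d
  generalize (starRingEnd ℂ) a = a'
  generalize (starRingEnd ℂ) b = b'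
  generalize (starRingEnd ℂ) d = d'
  linear_combination (a * a' + 2 * b * b' + d * d' + a * d' + d * a') * hσ

/-- The coin preserves the norm at each site, and the shift merely reindexes the sum of each
component. -/
theorem hasSum_prob_step {θ : ℝ} {ψ : State} {p : ℝ} (h : HasSum (prob ψ) p) :
    HasSum (prob (step θ ψ)) p := by
  rw [← funext (prob_applyCoin θ ψ)] at h
  unfold step
  set χ := applyCoin θ ψ
  have hs (j : Fin 3) : Summable fun x => ‖χ x j‖ ^ 2 :=
    h.summable.of_nonneg_of_le (fun _ => by positivity) fun x => normSq_le_prob χ x j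
  have h' := ((hs 0).hasSum.add (hs 1).hasSum).add (hs 2).hasSum
  have hp : prob χ = fun x => ‖χ x 0‖ ^ 2 + ‖χ x 1‖ ^ 2 + ‖χ x 2‖ ^ 2 := by
    ext x
    rw [prob, Fin.sum_univ_three]
  rw [h.unique (hp ▸ h')]
  have h0 := (Equiv.addRight (1 : ℤ)).hasSum_iff.2 (hs 0).hasSum
  have h2 := (Equiv.subRight (1 : ℤ)).hasSum_iff.2 (hs 2).hasSum
  refine ((h0.add (hs 1).hasSum).add h2).congr_fun ?_
  intro x
  simp [prob, Fin.sum_univ_three, shift]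

theorem hasSum_prob_evolve {θ : ℝ} {ψ : State} {p : ℝ} (h : HasSum (prob ψ) p) (t : ℕ) :
    HasSum (prob (evolve θ ψ t)) p := by
  induction t with
  | zero => exact h
  | succ t ih => rw [evolve_succ]; exact hasSum_prob_step ih

/-! ### Convergence to the stationary part -/

theorem tendsto_evolve_sub_step {θ : ℝ} (hθ : -1 < Real.cos θ) {χ : State} {S : Finset ℤ}
    (hχ : ∀ x ∉ S, χ x = 0) (x : ℤ) (j : Fin 3) :
    Tendsto (fun t => evolve θ (χ - step θ χ) t x j) atTop (𝓝 0) := by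
  classical
  have hstep : ∀ (ψ : State) (R : Finset ℤ), (∀ x ∉ R, ψ x = 0) →
      ∃ R' : Finset ℤ, ∀ x ∉ R', step θ ψ x = 0 := by
    intro ψ R hR
    refine ⟨R ∪ R.image (· - 1) ∪ R.image (· + 1), fun x hx => ?_⟩
    simp only [Finset.mem_union, Finset.mem_image, not_or, not_exists, not_and] at hx
    have h0 := hR x hx.1.1
    have h1 := hR (x + 1) fun h => hx.1.2 _ h (by ring)
    have h2 := hR (x - 1) fun h => hx.2 _ h (by ring)
    ext j
    fin_cases j <;> simp [step_apply_zero, step_apply_one, step_apply_two, h0, h1, h2]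
  obtain ⟨S1, hS1⟩ := hstep χ S hχ
  have hw0 : ∀ x ∉ S ∪ S1, (χ - step θ χ) x = 0 := by
    intro x hx
    rw [Finset.mem_union, not_or] at hx
    rw [Pi.sub_apply, hχ x hx.1, hS1 x hx.2, sub_zero]
  obtain ⟨S2, hS2⟩ := hstep _ _ hw0
  have hsum : HasSum (prob (χ - step θ χ)) (∑ x ∈ S ∪ S1, prob (χ - step θ χ) x) :=
    hasSum_sum_of_ne_finset_zero fun x hx => by simp [prob, hw0 x hx]
  refine tendsto_zero_of_tendsto_sub (f := fun t x => evolve θ (χ - step θ χ) t x j)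
    (K := ∑ x ∈ S ∪ S1, prob (χ - step θ χ) x) (fun t R => ?_) (fun y => ?_) x
  · exact (Finset.sum_le_sum fun x _ => normSq_le_prob _ x j).trans
      (sum_le_hasSum R (fun x _ => prob_nonneg _ x) (hasSum_prob_evolve hsum t))
  · refine tendsto_wave_sub hθ (Real.cos_le_one θ) (fun t x => evolve θ (χ - step θ χ) t x j)
      (S ∪ S1 ∪ S2) (fun x hx => ?_) (fun x hx => ?_) (fun t x => ?_) y
    · rw [Finset.mem_union, not_or] at hx
      simp only [evolve_zero]
      rw [hw0 x hx.1, Pi.zero_apply]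
    · rw [Finset.mem_union, not_or] at hx
      change step θ (χ - step θ χ) x j = 0
      rw [hS2 x hx.2, Pi.zero_apply]
    · simp only [evolve_sub_step, evolve_succ, step_sub, Pi.sub_apply]
      -- Applying `1 - U` removes the factor `U - 1` from Cayley–Hamilton: the cubic relation for
      -- `χ` is the quadratic one for `χ - Uχ`.
      linear_combination -step_cayley_hamilton θ (evolve θ χ t) x j

/-- If the initial state is the sum of a stationary state and of `χ - U χ` with `χ` of finite
support, then the probabilities converge to those of the stationary state. -/
theorem tendsto_prob_evolve {θ : ℝ} (hθ : -1 < Real.cos θ) {ψ ξ χ : State} {S : Finset ℤ}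
    (hξ : step θ ξ = ξ) (hχ : ∀ x ∉ S, χ x = 0) (hψ : ψ = ξ + (χ - step θ χ)) (x : ℤ) :
    Tendsto (fun t => prob (evolve θ ψ t) x) atTop (𝓝 (prob ξ x)) := by
  refine tendsto_finsetSum _ fun j _ => Tendsto.pow (Tendsto.norm ?_) 2
  have h := (tendsto_evolve_sub_step hθ hχ x j).const_add (ξ x j)
  rw [add_zero] at h
  refine h.congr fun t => ?_
  rw [hψ, evolve_add, evolve_eq_self hξ]
  rfl

/-! ### Stationary states and the splitting of the delocalized state -/

/-- The stationary state with profile `h`. -/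
noncomputable def stationary (θ : ℝ) (h : ℤ → ℂ) : State := fun x =>
  ![(1 - (Real.cos θ : ℂ)) * h (x + 1), sideEntry θ * (h x + h (x + 1)),
    (1 - (Real.cos θ : ℂ)) * h x]

theorem step_stationary (θ : ℝ) (h : ℤ → ℂ) : step θ (stationary θ h) = stationary θ h := by
  have hσ := sideEntry_sq θ
  ext x j
  have e1 : x - 1 + 1 = x := by ring
  fin_cases j
  all_goals
    simp only [Fin.zero_eta, Fin.mk_one, Fin.reduceFinMk, step_apply_zero, step_apply_one,
      step_apply_two, stationary, Matrix.cons_val_zero, Matrix.cons_val_one, Matrix.cons_val, e1]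
  · linear_combination (h (x + 1) + h (x + 1 + 1)) * hσ
  · ring
  · linear_combination (h (x - 1) + h x) * hσ

theorem prob_stationary (θ : ℝ) (h : ℤ → ℂ) (x : ℤ) :
    prob (stationary θ h) x = (1 - Real.cos θ) ^ 2 * (‖h x‖ ^ 2 + ‖h (x + 1)‖ ^ 2)
      + Real.sin θ ^ 2 / 2 * ‖h x + h (x + 1)‖ ^ 2 := by
  have h1 : ‖(1 - (Real.cos θ : ℂ))‖ ^ 2 = (1 - Real.cos θ) ^ 2 := by
    rw [← Complex.ofReal_one, ← Complex.ofReal_sub, Complex.norm_real, Real.norm_eq_abs, sq_abs]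
  have h2 : ‖sideEntry θ‖ ^ 2 = Real.sin θ ^ 2 / 2 := by
    rw [sideEntry, Complex.norm_real, Real.norm_eq_abs, sq_abs, div_pow,
      Real.sq_sqrt (by norm_num)]
  simp only [prob, Fin.sum_univ_three, stationary, Matrix.cons_val_zero, Matrix.cons_val_one,
    Matrix.cons_val, norm_mul, mul_pow, h1, h2]
  ring

/-- The potential `χ` such that the delocalized state is stationary up to `χ - U χ`. -/
noncomputable def potential (θ : ℝ) (F : ℤ → ℂ) (φ : Fin 3 → ℂ) : State := fun x j =>
  (1 + (Real.cos θ : ℂ))⁻¹ * (step θ (fun x => F x • φ) x j + (2 - Real.cos θ) * (F x * φ j)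
    + (1 + (Real.cos θ : ℂ)) / 2 * (F (x + 1) * φ j + F (x - 1) * φ j))

/-- This is `p(1) = p(U) + (1-U)(U + 2 - w)` applied to `Fφ / (1+c)`: the potential is the term `U +
2 - w`, and `p(U)Fφ / (1+c)` is computed as an explicit stationary state. -/
theorem delocalized_eq (θ : ℝ) (hs : Real.sin θ ≠ 0) (F : ℤ → ℂ) (α β γ : ℂ) :
    delocalized θ F ![α, β, γ] =
      stationary θ (fun x => (2 * (Real.sin θ : ℂ) ^ 2)⁻¹ *
        (coeffA θ α β * F (x - 1) + coeffB θ β γ * F x)) +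
      (potential θ F ![α, β, γ] - step θ (potential θ F ![α, β, γ])) := by
  have hσ := sideEntry_sq θ
  have hsq : (√2 * Real.sin θ : ℝ) = 2 * (Real.sin θ / √2) := by
    have : √2 ^ 2 = 2 := Real.sq_sqrt (by norm_num)
    field_simp
    rw [this]
  have hb : ((√2 * Real.sin θ : ℝ) : ℂ) = 2 * sideEntry θ := by
    rw [hsq, sideEntry]; push_cast; ring
  have hs2 : (Real.sin θ : ℂ) ^ 2 = (1 - Real.cos θ) * (1 + Real.cos θ) := by
    have := Real.sin_sq θ
    rw [← Complex.ofReal_pow, this]; push_cast; ring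
  have hne : (Real.sin θ : ℂ) ^ 2 ≠ 0 := by exact_mod_cast pow_ne_zero 2 hs
  rw [hs2] at hne
  obtain ⟨hm, hp⟩ := mul_ne_zero_iff.1 hne
  ext x j
  have e1 : x + 1 - 1 = x := by ring
  have e2 : x - 1 + 1 = x := by ring
  fin_cases j
  all_goals
    simp only [Fin.zero_eta, Fin.mk_one, Fin.reduceFinMk, Pi.add_apply, Pi.sub_apply,
      delocalized, stationary, potential, coeffA, coeffB, hb, hs2, step_apply_zero,
      step_apply_one, step_apply_two, Matrix.cons_val_zero, Matrix.cons_val_one, Matrix.cons_val,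
      Pi.smul_apply, smul_eq_mul, e1, e2]
    generalize sideEntry θ = σ at *
    generalize Real.cos θ = c at *
    push_cast
    field_simp
  · linear_combination 4 * F (x + 1) * (α + γ) * hσ
  · linear_combination (-2 * c * β * (F (x - 1) + F (x + 1)) - 4 * β * F x) * hσ
  · linear_combination 4 * F (x - 1) * (α + γ) * hσ
-- The even step function, its normalization and the Fourier exchange
theorem normConst_pos (θ : ℝ) {n : ℕ} (hn : 0 < n) : 0 < normConst θ n := by
  unfold normConst
  have h : (1 : ℝ) ≤ n := by exact_mod_cast hn
  nlinarith [sq_nonneg ((3 - Real.cos θ) / (1 + Real.cos θ))]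

theorem evenStep_of_even {θ : ℝ} {n : ℕ} {x : ℤ} (h0 : 0 ≤ x) (h1 : x ≤ 2 * n - 2)
    (h2 : x % 2 = 0) : evenStep θ n x = ((1 / √(normConst θ n) : ℝ) : ℂ) :=
  if_pos ⟨h0, h1, Int.even_iff.2 h2⟩

theorem evenStep_of_odd {θ : ℝ} {n : ℕ} {x : ℤ} (h : x % 2 = 1) : evenStep θ n x = 0 :=
  if_neg fun h' => by have := Int.even_iff.1 h'.2.2; omega

theorem evenStep_of_lt {θ : ℝ} {n : ℕ} {x : ℤ} (h : x < 0 ∨ 2 * n - 2 < x) :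
    evenStep θ n x = 0 :=
  if_neg fun h' => by omega

/-- The scalar factor of the delocalized state generated by `F`. -/
noncomputable def profile (θ : ℝ) (F : ℤ → ℂ) (x : ℤ) : ℂ :=
  1 / 2 * F (x - 1) + (((3 - Real.cos θ) / (1 + Real.cos θ) : ℝ) : ℂ) * F x + 1 / 2 * F (x + 1)

theorem profile_boundary (θ : ℝ) {n : ℕ} (hn : 0 < n) {x : ℤ} (hx : x = -1 ∨ x = 2 * n - 1) :
    profile θ (evenStep θ n) x = ((1 / (2 * √(normConst θ n)) : ℝ) : ℂ) := by
  unfold profile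
  rcases hx with rfl | rfl
  · rw [evenStep_of_lt (by omega), evenStep_of_lt (by omega), evenStep_of_even (by omega)
      (by omega) (by omega)]
    push_cast
    ring
  · rw [evenStep_of_even (x := 2 * (n : ℤ) - 1 - 1) (by omega) (by omega) (by omega),
      evenStep_of_lt (by omega), evenStep_of_lt (by omega)]
    push_cast
    ring

theorem profile_even (θ : ℝ) {n : ℕ} {x : ℤ} (h0 : 0 ≤ x) (h1 : x ≤ 2 * n - 2)
    (h2 : x % 2 = 0) : profile θ (evenStep θ n) x =
      (((3 - Real.cos θ) / ((1 + Real.cos θ) * √(normConst θ n)) : ℝ) : ℂ) := by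
  unfold profile
  rw [evenStep_of_odd (by omega), evenStep_of_even h0 h1 h2, evenStep_of_odd (by omega),
    ← div_div]
  push_cast
  ring

theorem profile_odd (θ : ℝ) {n : ℕ} {x : ℤ} (h0 : 1 ≤ x) (h1 : x ≤ 2 * n - 3)
    (h2 : x % 2 = 1) : profile θ (evenStep θ n) x = ((1 / √(normConst θ n) : ℝ) : ℂ) := by
  unfold profile
  rw [evenStep_of_even (x := x - 1) (by omega) (by omega) (by omega), evenStep_of_odd h2,
    evenStep_of_even (x := x + 1) (by omega) (by omega) (by omega)]
  ring

theorem profile_outside (θ : ℝ) {n : ℕ} {x : ℤ} (hx : x < -1 ∨ 2 * n - 1 < x) :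
    profile θ (evenStep θ n) x = 0 := by
  unfold profile
  rw [evenStep_of_lt (by omega), evenStep_of_lt (by omega), evenStep_of_lt (by omega)]
  ring

theorem sum_range_alternate (a b : ℝ) (m : ℕ) :
    ∑ i ∈ Finset.range (2 * m + 1), (if i % 2 = 0 then a else b) = (m + 1) * a + m * b := by
  induction m with
  | zero => simp
  | succ m ih =>
    rw [show 2 * (m + 1) + 1 = 2 * m + 1 + 1 + 1 by ring, Finset.sum_range_succ,
      Finset.sum_range_succ, ih, if_neg (by omega), if_pos (by omega)]
    push_cast
    ring

theorem hasSum_normSq_profile (θ : ℝ) {n : ℕ} (hn : 0 < n) :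
    HasSum (fun x => ‖profile θ (evenStep θ n) x‖ ^ 2) 1 := by
  obtain ⟨m, rfl⟩ : ∃ m, n = m + 1 := ⟨n - 1, by omega⟩
  have hM := normConst_pos θ hn
  have hr (a : ℝ) : ‖(a : ℂ)‖ ^ 2 = a ^ 2 := by rw [Complex.norm_real, Real.norm_eq_abs, sq_abs]
  set f : ℤ → ℝ := fun x => ‖profile θ (evenStep θ (m + 1)) x‖ ^ 2 with hf
  have hsq : √(normConst θ (m + 1)) ^ 2 = normConst θ (m + 1) := Real.sq_sqrt hM.le
  have hb {x : ℤ} (hx : x = -1 ∨ x = 2 * ((m + 1 : ℕ) : ℤ) - 1) :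
      f x = 1 / 4 / normConst θ (m + 1) := by
    simp only [hf]
    rw [profile_boundary θ hn hx, hr, div_pow, mul_pow, hsq]
    ring
  have hi : ∀ i ∈ Finset.range (2 * m + 1), f (((i + 1 : ℕ) : ℤ) - 1) =
      if i % 2 = 0 then ((3 - Real.cos θ) / (1 + Real.cos θ)) ^ 2 / normConst θ (m + 1)
        else 1 / normConst θ (m + 1) := by
    intro i hi
    rw [Finset.mem_range] at hi
    simp only [hf]
    split_ifs with h
    · rw [profile_even θ (by omega) (by omega) (by omega), hr, ← div_div, div_pow, hsq]
    · rw [profile_odd θ (by omega) (by omega) (by omega), hr, div_pow, hsq, one_pow]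
  -- With `n = m + 1`, the `2m + 3` indices shifted by `-1` run over `-1, …, 2n - 1`. Peeling off
  -- both ends leaves an alternating sum that starts and ends at even sites.
  have hs : HasSum f (∑ x ∈ (Finset.range (2 * m + 3)).image (fun i : ℕ => (i : ℤ) - 1), f x) := by
    refine hasSum_sum_of_ne_finset_zero fun x hx => ?_
    have : x < -1 ∨ 2 * ((m + 1 : ℕ) : ℤ) - 1 < x := by
      by_contra hcon
      refine hx (Finset.mem_image.2 ⟨(x + 1).toNat, ?_, ?_⟩)
      · rw [Finset.mem_range]; omega
      · omega
    simp only [hf]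
    rw [profile_outside θ this]
    simp
  rw [Finset.sum_image (by intro a _ b _ h; simpa using h), Finset.sum_range_succ,
    Finset.sum_range_succ', Finset.sum_congr rfl hi, sum_range_alternate, hb (by omega),
    hb (by omega)] at hs
  convert hs using 1
  rw [eq_comm]
  have hne := hM.ne'
  have hval : normConst θ (m + 1) =
      (1 + ((3 - Real.cos θ) / (1 + Real.cos θ)) ^ 2) * (m + 1) - 1 / 2 := by
    simp [normConst]
  generalize (3 - Real.cos θ) / (1 + Real.cos θ) = r at *
  field_simp
  rw [hval]
  ring

theorem prob_delocalized (θ : ℝ) (F : ℤ → ℂ) {α β γ : ℂ}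
    (hφ : ‖α‖ ^ 2 + ‖β‖ ^ 2 + ‖γ‖ ^ 2 = 1) (x : ℤ) :
    prob (delocalized θ F ![α, β, γ]) x = ‖profile θ F x‖ ^ 2 := by
  simp only [prob, Fin.sum_univ_three, delocalized, Pi.smul_apply, smul_eq_mul, norm_mul, mul_pow,
    Matrix.cons_val_zero, Matrix.cons_val_one, Matrix.cons_val]
  rw [← mul_add, ← mul_add, hφ, mul_one]
  rfl

theorem potential_eq_zero {θ : ℝ} {F : ℤ → ℂ} {x : ℤ} (φ : Fin 3 → ℂ) (h0 : F x = 0)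
    (h1 : F (x - 1) = 0) (h2 : F (x + 1) = 0) : potential θ F φ x = 0 := by
  ext j
  fin_cases j <;> simp [potential, step_apply_zero, step_apply_one, step_apply_two, h0, h1, h2]

/-- Summation and Fourier integration commute for a finitely supported generating function. -/
theorem fourier_exchange (F : ℤ → ℂ) (S : Finset ℤ) (hF : ∀ x ∉ S, F x = 0) (y : ℤ) :
    (∀ k : ℝ, Summable fun x : ℤ => Complex.exp (-(Complex.I * k * (x - y))) * F x) ∧
      IntervalIntegrable (fun k : ℝ => ∑' x : ℤ, Complex.exp (-(Complex.I * k * (x - y))) * F x)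
        MeasureTheory.volume (-Real.pi) Real.pi ∧
      HasSum (fun x : ℤ =>
          ∫ k : ℝ in (-Real.pi)..Real.pi, Complex.exp (-(Complex.I * k * (x - y))) * F x)
        (∫ k : ℝ in (-Real.pi)..Real.pi,
          ∑' x : ℤ, Complex.exp (-(Complex.I * k * (x - y))) * F x) := by
  have hs (k : ℝ) : HasSum (fun x : ℤ => Complex.exp (-(Complex.I * k * (x - y))) * F x)
      (∑ x ∈ S, Complex.exp (-(Complex.I * k * (x - y))) * F x) :=
    hasSum_sum_of_ne_finset_zero fun x hx => by simp [hF x hx]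
  have hi (x : ℤ) : IntervalIntegrable
      (fun k : ℝ => Complex.exp (-(Complex.I * k * (x - y))) * F x)
      MeasureTheory.volume (-Real.pi) Real.pi :=
    (by fun_prop : Continuous _).intervalIntegrable _ _
  refine ⟨fun k => (hs k).summable, ?_, ?_⟩
  · simp_rw [fun k => (hs k).tsum_eq]
    exact (by fun_prop : Continuous _).intervalIntegrable _ _
  · simp_rw [fun k => (hs k).tsum_eq]
    rw [intervalIntegral.integral_finsetSum fun x _ => hi x]
    exact hasSum_sum_of_ne_finset_zero fun x hx => by simp [hF x hx]

/-! ### Evaluation of the limit probabilities -/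

/-- The profile of the stationary part of the walk started from the delocalized state. -/
noncomputable def limitProfile (θ : ℝ) (n : ℕ) (A B : ℂ) (x : ℤ) : ℂ :=
  (2 * (Real.sin θ : ℂ) ^ 2)⁻¹ * (A * evenStep θ n (x - 1) + B * evenStep θ n x)

theorem limitProfile_even (θ : ℝ) {n : ℕ} (A B : ℂ) {x : ℤ} (h0 : 0 ≤ x) (h1 : x ≤ 2 * n - 2)
    (h2 : x % 2 = 0) : limitProfile θ n A B x =
      (((2 * Real.sin θ ^ 2)⁻¹ * (1 / √(normConst θ n)) : ℝ) : ℂ) * B := by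
  rw [limitProfile, evenStep_of_odd (by omega), evenStep_of_even h0 h1 h2]
  push_cast
  ring

theorem limitProfile_odd (θ : ℝ) {n : ℕ} (A B : ℂ) {x : ℤ} (h0 : 1 ≤ x) (h1 : x ≤ 2 * n - 1)
    (h2 : x % 2 = 1) : limitProfile θ n A B x =
      (((2 * Real.sin θ ^ 2)⁻¹ * (1 / √(normConst θ n)) : ℝ) : ℂ) * A := by
  rw [limitProfile, evenStep_of_even (by omega) (by omega) (by omega), evenStep_of_odd h2]
  push_cast
  ring

/-- The factor `0` is kept so that outside sites have the same form as interior ones and enter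
`prob_stationary_of_eq` with `a = 0` or `b = 0`. -/
theorem limitProfile_outside (θ : ℝ) {n : ℕ} (A B : ℂ) {x : ℤ} (h : x < 0 ∨ 2 * n - 1 < x) :
    limitProfile θ n A B x =
      (((2 * Real.sin θ ^ 2)⁻¹ * (1 / √(normConst θ n)) : ℝ) : ℂ) * 0 := by
  rw [limitProfile, evenStep_of_lt (by omega), evenStep_of_lt (by omega)]
  simp

/-- The limit probability at a point whose two neighbouring amplitudes are `a` and `b`. -/
noncomputable def limitValue (c M : ℝ) (a b : ℂ) : ℝ :=
  1 / (4 * (1 + c) * M) * ((‖a‖ ^ 2 + ‖b‖ ^ 2) / (1 + c) + ‖a + b‖ ^ 2 / (2 * (1 - c)))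

theorem prob_stationary_of_eq {θ : ℝ} (hs : Real.sin θ ≠ 0) {n : ℕ} (hn : 0 < n) {h : ℤ → ℂ}
    {x : ℤ} {a b : ℂ}
    (ha : h x = (((2 * Real.sin θ ^ 2)⁻¹ * (1 / √(normConst θ n)) : ℝ) : ℂ) * a)
    (hb : h (x + 1) = (((2 * Real.sin θ ^ 2)⁻¹ * (1 / √(normConst θ n)) : ℝ) : ℂ) * b) :
    prob (stationary θ h) x = limitValue (Real.cos θ) (normConst θ n) a b := by
  have hsq : Real.sin θ ^ 2 = (1 - Real.cos θ) * (1 + Real.cos θ) := by rw [Real.sin_sq]; ring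
  have hM := normConst_pos θ hn
  have hne := pow_ne_zero 2 hs
  have hr : √(normConst θ n) ^ 2 = normConst θ n := Real.sq_sqrt hM.le
  rw [hsq] at hne
  obtain ⟨h1, h2⟩ := mul_ne_zero_iff.1 hne
  rw [prob_stationary, ha, hb, ← mul_add, norm_mul, norm_mul, norm_mul, Complex.norm_real,
    Real.norm_eq_abs, mul_pow, mul_pow, mul_pow, sq_abs, mul_pow, div_pow, hr, hsq, limitValue]
  have := hM.ne'
  field_simp
  ring

theorem tendsto_prob_delocalized {θ : ℝ} (hs : Real.sin θ ≠ 0) (n : ℕ) (α β γ : ℂ) (x : ℤ) :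
    Tendsto (fun t => prob (evolve θ (delocalized θ (evenStep θ n) ![α, β, γ]) t) x) atTop
      (𝓝 (prob (stationary θ (limitProfile θ n (coeffA θ α β) (coeffB θ β γ))) x)) := by
  have hc : -1 < Real.cos θ := by
    refine lt_of_le_of_ne (Real.neg_one_le_cos θ) fun h => hs ?_
    have := Real.sin_sq θ
    rw [← h] at this
    exact pow_eq_zero_iff two_ne_zero |>.1 (by rw [this]; norm_num)
  refine tendsto_prob_evolve hc (step_stationary θ _) (S := Finset.Icc (-1) (2 * n))
    (χ := potential θ (evenStep θ n) ![α, β, γ]) (fun x hx => ?_)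
    (delocalized_eq θ hs (evenStep θ n) α β γ) x
  rw [Finset.mem_Icc] at hx
  exact potential_eq_zero _ (evenStep_of_lt (by omega)) (evenStep_of_lt (by omega))
    (evenStep_of_lt (by omega))

/-- This symmetry is why even and odd interior sites, which see `A` and `B` in opposite orders, have
the same limit. -/
theorem limitValue_comm (c M : ℝ) (a b : ℂ) : limitValue c M a b = limitValue c M b a := by
  unfold limitValue
  rw [add_comm (‖a‖ ^ 2), add_comm a]

theorem limitValue_zero_zero (c M : ℝ) : limitValue c M 0 0 = 0 := by
  simp [limitValue]

theorem limitValue_zero_left {c s : ℝ} (hs : s ≠ 0) (h : s ^ 2 = (1 - c) * (1 + c)) (M : ℝ)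
    (b : ℂ) : limitValue c M 0 b = (3 - c) * ‖b‖ ^ 2 / (8 * (1 + c) * s ^ 2 * M) := by
  have hne := pow_ne_zero 2 hs
  rw [h] at hne
  obtain ⟨h1, h2⟩ := mul_ne_zero_iff.1 hne
  rw [h]
  rcases eq_or_ne M 0 with rfl | hM
  · simp [limitValue]
  simp only [limitValue, zero_add, norm_zero]
  field_simp
  ring

theorem limitValue_neg (c M : ℝ) (a : ℂ) :
    limitValue c M a (-a) = ‖a‖ ^ 2 / (2 * (1 + c) ^ 2 * M) := by
  simp only [limitValue, norm_neg, add_neg_cancel, norm_zero]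
  rw [zero_pow two_ne_zero, zero_div, add_zero, div_mul_div_comm, one_mul,
    ← mul_div_mul_left (‖a‖ ^ 2) _ (two_ne_zero (α := ℝ))]
  congr 1 <;> ring

end ThreeStateWalk

/-! ### The main theorem -/

open ThreeStateWalk in
theorem lemma1 (θ : ℝ) (hθ : θ ∈ Set.Ico 0 (2 * Real.pi)) (hθ0 : θ ≠ 0) (hθπ : θ ≠ Real.pi)
    (n : ℕ) (hn : 0 < n) (α β γ : ℂ) (hφ : ‖α‖ ^ 2 + ‖β‖ ^ 2 + ‖γ‖ ^ 2 = 1)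
    (c s M : ℝ) (hc : c = Real.cos θ) (hs : s = Real.sin θ) (hM : M = normConst θ n)
    (A B : ℂ) (hA : A = coeffA θ α β) (hB : B = coeffB θ β γ)
    (F : ℤ → ℂ) (hF : F = evenStep θ n)
    (φ : Fin 3 → ℂ) (hφ' : φ = ![α, β, γ])
    (ψ₀ : State) (hψ₀ : ψ₀ = delocalized θ F φ)
    (P : ℕ → ℤ → ℝ) (hP : P = fun t x => prob (evolve θ ψ₀ t) x) :
    -- `F` satisfies the two requirements on a generating function
    HasSum (fun x : ℤ => ‖1 / 2 * F (x - 1) + (((3 - c) / (1 + c) : ℝ) : ℂ) * F x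
      + 1 / 2 * F (x + 1)‖ ^ 2) 1 ∧
    (∀ y : ℤ,
      (∀ k : ℝ, Summable fun x : ℤ => Complex.exp (-(Complex.I * k * (x - y))) * F x) ∧
      IntervalIntegrable (fun k : ℝ => ∑' x : ℤ, Complex.exp (-(Complex.I * k * (x - y))) * F x)
        MeasureTheory.volume (-Real.pi) Real.pi ∧
      HasSum (fun x : ℤ =>
          ∫ k : ℝ in (-Real.pi)..Real.pi, Complex.exp (-(Complex.I * k * (x - y))) * F x)
        (∫ k : ℝ in (-Real.pi)..Real.pi,
          ∑' x : ℤ, Complex.exp (-(Complex.I * k * (x - y))) * F x)) ∧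
    -- the initial state is a unit vector
    0 < M ∧ HasSum (fun x : ℤ => prob ψ₀ x) 1 ∧
    -- the initial state
    (∀ x : ℤ, (x = -1 ∨ x = 2 * n - 1) → ψ₀ x = ((1 / (2 * √M) : ℝ) : ℂ) • φ) ∧
    (∀ x : ℤ, 0 ≤ x → x ≤ 2 * n - 2 → Even x →
      ψ₀ x = (((3 - c) / ((1 + c) * √M) : ℝ) : ℂ) • φ) ∧
    (∀ x : ℤ, 1 ≤ x → x ≤ 2 * n - 3 → Odd x → ψ₀ x = ((1 / √M : ℝ) : ℂ) • φ) ∧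
    (∀ x : ℤ, x < -1 ∨ 2 * n - 1 < x → ψ₀ x = 0) ∧
    -- the limit measure
    Tendsto (fun t => P t (-1)) atTop
      (𝓝 ((3 - c) * ‖B‖ ^ 2 / (8 * (1 + c) * s ^ 2 * M))) ∧
    (∀ x : ℤ, 0 ≤ x → x ≤ 2 * n - 2 → Tendsto (fun t => P t x) atTop
      (𝓝 (1 / (4 * (1 + c) * M) *
        ((‖A‖ ^ 2 + ‖B‖ ^ 2) / (1 + c) + ‖A + B‖ ^ 2 / (2 * (1 - c)))))) ∧
    Tendsto (fun t => P t (2 * n - 1)) atTop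
      (𝓝 ((3 - c) * ‖A‖ ^ 2 / (8 * (1 + c) * s ^ 2 * M))) ∧
    (∀ x : ℤ, x < -1 ∨ 2 * n - 1 < x → Tendsto (fun t => P t x) atTop (𝓝 0)) ∧
    -- `A = 0`, `B ≠ 0`: a uniform limit measure on `2n` points
    (A = 0 → B ≠ 0 → (Finset.Icc (-1 : ℤ) (2 * n - 2)).card = 2 * n ∧
      HasUniformLimit P (Finset.Icc (-1) (2 * n - 2))
        ((3 - c) * ‖B‖ ^ 2 / (8 * (1 + c) * s ^ 2 * M))) ∧
    (α = 0 → β = 0 → γ = 1 → A = 0 ∧ B ≠ 0) ∧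
    -- `A ≠ 0`, `B = 0`: a uniform limit measure on `2n` points
    (A ≠ 0 → B = 0 → (Finset.Icc (0 : ℤ) (2 * n - 1)).card = 2 * n ∧
      HasUniformLimit P (Finset.Icc 0 (2 * n - 1))
        ((3 - c) * ‖A‖ ^ 2 / (8 * (1 + c) * s ^ 2 * M))) ∧
    (α = 1 → β = 0 → γ = 0 → A ≠ 0 ∧ B = 0) ∧
    -- `B = -A ≠ 0`
    (B = -A → A ≠ 0 →
      (∀ x : ℤ, (x = -1 ∨ x = 2 * n - 1) → Tendsto (fun t => P t x) atTop
        (𝓝 ((3 - c) * ‖A‖ ^ 2 / (8 * (1 + c) * s ^ 2 * M)))) ∧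
      (∀ x : ℤ, 0 ≤ x → x ≤ 2 * n - 2 → Tendsto (fun t => P t x) atTop
        (𝓝 (‖A‖ ^ 2 / (2 * (1 + c) ^ 2 * M)))) ∧
      (∀ x : ℤ, x < -1 ∨ 2 * n - 1 < x → Tendsto (fun t => P t x) atTop (𝓝 0))) ∧
    -- `B = -A ≠ 0` with `c = 1/3`, `s = ±2√2/3`: a uniform limit measure on `2n + 1` points
    (∀ ε : ℝ, (ε = 1 ∨ ε = -1) → c = 1 / 3 → s = ε * (2 * √2 / 3) →
      ((B = -A ∧ A ≠ 0) ↔ (β = -(ε : ℂ) * (1 / 2) * (α + γ) ∧ γ ≠ α)) ∧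
      (β = -(ε : ℂ) * (1 / 2) * (α + γ) → γ ≠ α →
        (Finset.Icc (-1 : ℤ) (2 * n - 1)).card = 2 * n + 1 ∧
        HasUniformLimit P (Finset.Icc (-1) (2 * n - 1))
          (‖α - γ‖ ^ 2 / (4 * (10 * (n : ℝ) - 1))))) := by
  subst hψ₀ hφ' hF hP hc hs hM
  have hs0 : Real.sin θ ≠ 0 := by
    intro h
    obtain ⟨m, hm⟩ := Real.sin_eq_zero_iff.1 h
    have hpi := Real.pi_pos
    have h1 : (-1 : ℝ) < m := by nlinarith [hθ.1]
    have h2 : (m : ℝ) < 2 := by nlinarith [hθ.2]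
    have h1' : -1 < m := by exact_mod_cast h1
    have h2' : m < 2 := by exact_mod_cast h2
    obtain rfl | rfl : m = 0 ∨ m = 1 := by omega
    · exact hθ0 (by rw [← hm]; simp)
    · exact hθπ (by rw [← hm]; simp)
  have hsq : Real.sin θ ^ 2 = (1 - Real.cos θ) * (1 + Real.cos θ) := by rw [Real.sin_sq]; ring
  have hM := normConst_pos θ hn
  have hs2 : 0 < Real.sin θ ^ 2 := by positivity
  have h1c : 0 < 1 + Real.cos θ := by
    nlinarith [Real.neg_one_le_cos θ, Real.cos_le_one θ]
  have h2c : 0 < 1 - Real.cos θ := by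
    nlinarith [Real.neg_one_le_cos θ, Real.cos_le_one θ]
  have h3c : 0 < 3 - Real.cos θ := by linarith
  have hlim {x : ℤ} {a b : ℂ}
      (ha : limitProfile θ n A B x =
        (((2 * Real.sin θ ^ 2)⁻¹ * (1 / √(normConst θ n)) : ℝ) : ℂ) * a)
      (hb : limitProfile θ n A B (x + 1) =
        (((2 * Real.sin θ ^ 2)⁻¹ * (1 / √(normConst θ n)) : ℝ) : ℂ) * b) :
      Tendsto (fun t => prob (evolve θ (delocalized θ (evenStep θ n) ![α, β, γ]) t) x) atTop
        (𝓝 (limitValue (Real.cos θ) (normConst θ n) a b)) := by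
    rw [← prob_stationary_of_eq hs0 hn ha hb, hA, hB]
    exact tendsto_prob_delocalized hs0 n α β γ x
  have hleft : Tendsto (fun t => prob (evolve θ (delocalized θ (evenStep θ n) ![α, β, γ]) t) (-1))
      atTop (𝓝 ((3 - Real.cos θ) * ‖B‖ ^ 2 /
        (8 * (1 + Real.cos θ) * Real.sin θ ^ 2 * normConst θ n))) := by
    rw [← limitValue_zero_left hs0 hsq]
    exact hlim (limitProfile_outside θ A B (by omega))
      (limitProfile_even θ A B (by omega) (by omega) (by omega))
  have hright : Tendsto
      (fun t => prob (evolve θ (delocalized θ (evenStep θ n) ![α, β, γ]) t) (2 * n - 1))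
      atTop (𝓝 ((3 - Real.cos θ) * ‖A‖ ^ 2 /
        (8 * (1 + Real.cos θ) * Real.sin θ ^ 2 * normConst θ n))) := by
    rw [← limitValue_zero_left hs0 hsq, limitValue_comm]
    exact hlim (limitProfile_odd θ A B (by omega) (by omega) (by omega))
      (limitProfile_outside θ A B (by omega))
  have hmid : ∀ x : ℤ, 0 ≤ x → x ≤ 2 * n - 2 →
      Tendsto (fun t => prob (evolve θ (delocalized θ (evenStep θ n) ![α, β, γ]) t) x) atTop
        (𝓝 (limitValue (Real.cos θ) (normConst θ n) A B)) := by
    intro x h0 h1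
    rcases Int.emod_two_eq_zero_or_one x with h | h
    · rw [limitValue_comm]
      exact hlim (limitProfile_even θ A B h0 h1 h)
        (limitProfile_odd θ A B (by omega) (by omega) (by omega))
    · exact hlim (limitProfile_odd θ A B (by omega) (by omega) h)
        (limitProfile_even θ A B (by omega) (by omega) (by omega))
  have hout : ∀ x : ℤ, x < -1 ∨ 2 * n - 1 < x →
      Tendsto (fun t => prob (evolve θ (delocalized θ (evenStep θ n) ![α, β, γ]) t) x) atTop
        (𝓝 0) := by
    intro x hx
    rw [← limitValue_zero_zero (Real.cos θ) (normConst θ n)]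
    exact hlim (limitProfile_outside θ A B (by omega)) (limitProfile_outside θ A B (by omega))
  have hne2 : ((2 * (1 - Real.cos θ) : ℝ) : ℂ) ≠ 0 := by exact_mod_cast (by positivity)
  have hopp : B = -A → A ≠ 0 →
      (∀ x : ℤ, (x = -1 ∨ x = 2 * n - 1) →
        Tendsto (fun t => prob (evolve θ (delocalized θ (evenStep θ n) ![α, β, γ]) t) x) atTop
        (𝓝 ((3 - Real.cos θ) * ‖A‖ ^ 2 /
          (8 * (1 + Real.cos θ) * Real.sin θ ^ 2 * normConst θ n)))) ∧
      (∀ x : ℤ, 0 ≤ x → x ≤ 2 * n - 2 →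
        Tendsto (fun t => prob (evolve θ (delocalized θ (evenStep θ n) ![α, β, γ]) t) x) atTop
        (𝓝 (‖A‖ ^ 2 / (2 * (1 + Real.cos θ) ^ 2 * normConst θ n)))) ∧
      (∀ x : ℤ, x < -1 ∨ 2 * n - 1 < x →
        Tendsto (fun t => prob (evolve θ (delocalized θ (evenStep θ n) ![α, β, γ]) t) x) atTop
        (𝓝 0)) := by
    intro hBA _
    refine ⟨?_, fun x h0 h1 => ?_, hout⟩
    · rintro x (rfl | rfl)
      · rwa [hBA, norm_neg] at hleft
      · exact hright
    · rw [← limitValue_neg, ← hBA]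
      exact hmid x h0 h1
  refine ⟨hasSum_normSq_profile θ hn,
    fourier_exchange _ (Finset.Icc 0 (2 * n - 2)) fun x hx => evenStep_of_lt ?_, hM, ?_, ?_, ?_,
    ?_, ?_, hleft, hmid, hright, hout, ?_, ?_, ?_, ?_, hopp, ?_⟩
  · rw [Finset.mem_Icc] at hx
    omega
  · rw [funext (prob_delocalized θ (evenStep θ n) hφ)]
    exact hasSum_normSq_profile θ hn
  · exact fun x hx => congrArg (· • ![α, β, γ]) (profile_boundary θ hn hx)
  · exact fun x h0 h1 h2 =>
      congrArg (· • ![α, β, γ]) (profile_even θ h0 h1 (Int.even_iff.1 h2))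
  · exact fun x h0 h1 h2 =>
      congrArg (· • ![α, β, γ]) (profile_odd θ h0 h1 (Int.odd_iff.1 h2))
  · exact fun x hx =>
      (congrArg (· • ![α, β, γ]) (profile_outside θ hx)).trans (zero_smul ℂ _)
  · intro hA0 hB0
    have hBpos : 0 < ‖B‖ := norm_pos_iff.2 hB0
    refine ⟨by rw [Int.card_Icc]; omega, by positivity, fun x hx => ?_, fun x hx => ?_⟩
    · rw [Finset.mem_Icc] at hx
      rcases eq_or_ne x (-1) with rfl | hx1
      · exact hleft
      · rw [← limitValue_zero_left hs0 hsq, ← hA0]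
        exact hmid x (by omega) hx.2
    · rw [Finset.mem_Icc] at hx
      rcases eq_or_ne x (2 * n - 1) with rfl | hx1
      · simpa [hA0] using hright
      · exact hout x (by omega)
  · rintro rfl rfl rfl
    rw [hA, hB]
    constructor
    · simp [coeffA]
    · simpa [coeffB] using hne2
  · intro hA0 hB0
    have hApos : 0 < ‖A‖ := norm_pos_iff.2 hA0
    refine ⟨by rw [Int.card_Icc]; omega, by positivity, fun x hx => ?_, fun x hx => ?_⟩
    · rw [Finset.mem_Icc] at hx
      rcases eq_or_ne x (2 * n - 1) with rfl | hx1
      · exact hright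
      · rw [← limitValue_zero_left hs0 hsq, limitValue_comm, ← hB0]
        exact hmid x (by omega) (by omega)
    · rw [Finset.mem_Icc] at hx
      rcases eq_or_ne x (-1) with rfl | hx1
      · simpa [hB0] using hleft
      · exact hout x (by omega)
  · rintro rfl rfl rfl
    rw [hA, hB]
    constructor
    · simpa [coeffA] using hne2
    · simp [coeffB]
  · intro ε hε hc hs
    have hε2 : (ε : ℂ) ^ 2 = 1 := by rcases hε with rfl | rfl <;> simp
    -- Here `2(1 - c) = 4/3` as well, so `4/3` factors out of both `A` and `B`.
    have h2s : √2 * Real.sin θ = ε * (4 / 3) := by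
      have : √2 ^ 2 = 2 := Real.sq_sqrt (by norm_num)
      rw [hs]
      linear_combination ε * (2 / 3) * this
    have hA' : A = 4 / 3 * (α + ε * β) := by
      rw [hA, coeffA, h2s, hc]
      push_cast
      ring
    have hB' : B = 4 / 3 * (ε * β + γ) := by
      rw [hB, coeffB, h2s, hc]
      push_cast
      ring
    have hiff : (B = -A ∧ A ≠ 0) ↔ (β = -(ε : ℂ) * (1 / 2) * (α + γ) ∧ γ ≠ α) := by
      have h1 : B = -A ↔ β = -(ε : ℂ) * (1 / 2) * (α + γ) := by
        rw [hA', hB']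
        constructor <;> intro h
        · linear_combination (3 / 8 * (ε : ℂ)) * h - β * hε2
        · linear_combination (8 / 3 * (ε : ℂ)) * h - (4 / 3 * (α + γ)) * hε2
      rw [h1]
      refine and_congr_right fun h => not_congr ?_
      have h2 : A = 2 / 3 * (α - γ) := by
        rw [hA']
        linear_combination (4 / 3 * (ε : ℂ)) * h - (2 / 3 * (α + γ)) * hε2
      rw [h2, mul_eq_zero, or_iff_right (by norm_num), sub_eq_zero, eq_comm]
    refine ⟨hiff, fun hβ hγ => ⟨by rw [Int.card_Icc]; omega, ?_⟩⟩
    obtain ⟨hBA, hA0⟩ := hiff.2 ⟨hβ, hγ⟩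
    have h2 : A = ((2 / 3 : ℝ) : ℂ) * (α - γ) := by
      rw [hA']
      push_cast
      linear_combination (4 / 3 * (ε : ℂ)) * hβ - (2 / 3 * (α + γ)) * hε2
    have hnorm : ‖A‖ ^ 2 = 4 / 9 * ‖α - γ‖ ^ 2 := by
      rw [h2, norm_mul, Complex.norm_real, Real.norm_eq_abs, mul_pow, sq_abs]
      ring
    have hn1 : (1 : ℝ) ≤ n := by exact_mod_cast hn
    have hn10 : 0 < 10 * (n : ℝ) - 1 := by linarith
    -- At `c = 1/3` the ratio `(3-c)/(1+c)` equals `2`.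
    have hMv : normConst θ n = (10 * (n : ℝ) - 1) / 2 := by
      rw [normConst, hc]
      ring
    obtain ⟨hbd, hin, _⟩ := hopp hBA hA0
    have hpos : 0 < ‖α - γ‖ := norm_pos_iff.2 (sub_ne_zero.2 hγ.symm)
    -- The end and interior values agree exactly when `3 - c = 4(1 - c)`, that is, `c = 1/3`.
    rw [hsq, hnorm, hMv, hc] at hbd
    rw [hnorm, hMv, hc] at hin
    refine ⟨by positivity, fun x hx => ?_, fun x hx => ?_⟩
    · rw [Finset.mem_Icc] at hx
      by_cases hx1 : x = -1 ∨ x = 2 * n - 1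
      · convert hbd x hx1 using 2
        field_simp
        norm_num
      · convert hin x (by omega) (by omega) using 2
        field_simp
        norm_num
    · rw [Finset.mem_Icc] at hx
      exact hout x (by omega)
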